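/- For multiplicities $m_1,m_2,m_3\ge 1$ put $n^*=m_1+m_2+m_3$, let $U_1,\dots,U_{n^*-1}$ be independent and uniform on $[0,1]$, independent of $(X_1,X_2,X_3)$, with order statistics $U_{(1)}\le\dots\le U_{(n^*-1)}$ and $U_{(0)}=0$, $U_{(n^*)}=1$. Put $R_1=U_{(m_1)}$, $R_2=U_{(m_1+m_2)}-U_{(m_1)}$, $R_3=1-U_{(m_1+m_2)}$ and $S_3=R_1X_1+R_2X_2+R_3X_3$. On $[-1,1]$, the arcsine distribution has density $\frac{1}{\pi\sqrt{1-x^2}}$ and the semicircle distribution has density $\frac{2}{\pi}\sqrt{1-x^2}$. Theorem 2. Let $X_1,X_2,X_3$ be independent random variables with values in $[-1,1]$; in (a), (b) and (e) they are moreover assumed to be identically distributed. (i) For $m_1=m_2=m_3=1$: (a) $S_3$ has the semicircle distribution on $[-1,1]$ if and only if $X_1,X_2,X_3$ have the arcsine distribution. (b) $X_1,X_2,X_3$ have the semicircle distribution on $[-1,1]$ if and only if $S_3$ has the power semicircle distribution with density $f(z)=\frac{16}{5\pi}(1-z^2)^{5/2}$, $-1\le z\le 1$. (c) If $X_1$ and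 $X_2$ have the semicircle distribution on $[-1,1]$, then $X_3$ has the arcsine distribution if and only if $S_3$ has the power semicircle distribution with density $f(z)=\frac{8}{3\pi}(1-z^2)^{3/2}$, $-1\le z\le 1$. (ii) For $m_1=3$, $m_2=m_3=1$: (d) If $X_2$ and $X_3$ have the arcsine distribution, then $X_1$ has the semicircle distribution on $[-1,1]$ if and only if $S_3$ has the power semicircle distribution with density $f(z)=\frac{8}{3\pi}(1-z^2)^{3/2}$, $-1\le z\le 1$. (iii) For $m_1=m_2=1$, $m_3=2$: (e) $X_1,X_2,X_3$ have the arcsine distribution on $[-1,1]$ if and only if $S_3$ has the semicircle distribution on $[-1,1]$. -/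

import Mathlib

open MeasureTheory ProbabilityTheory

/-- The order statistics of `u₁, …, u_N`, indexed so that `orderStat u k` is the `k`-th smallest
entry for `1 ≤ k ≤ N`, with the conventions `u₍₀₎ = 0` and `u₍ₖ₎ = 1` for `k ≥ N + 1`. -/
noncomputable def orderStat {N : ℕ} (u : Fin N → ℝ) : ℕ → ℝ
  | 0 => 0
  | k + 1 => if h : k < N then u (Tuple.sort u ⟨k, h⟩) else 1

/-- The `j`-th random weight `R_j = u₍ₖ₎ - u₍ₗ₎`, where `k = m₁ + ⋯ + m_j` and
`l = m₁ + ⋯ + m_{j-1}`. -/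
noncomputable def rwaWeight {n N : ℕ} (m : Fin n → ℕ) (u : Fin N → ℝ) (j : Fin n) : ℝ :=
  orderStat u (∑ i ∈ Finset.Iic j, m i) - orderStat u (∑ i ∈ Finset.Iio j, m i)

/-- The randomly weighted average `S = R₁ X₁ + ⋯ + R_n X_n` with multiplicities `m`.
It is meant to be used with `N = m₁ + ⋯ + m_n - 1` cut points `U`. -/
noncomputable def rwa {Ω : Type*} {n N : ℕ} (m : Fin n → ℕ) (U : Fin N → Ω → ℝ)
    (X : Fin n → Ω → ℝ) (ω : Ω) : ℝ :=
  ∑ j, rwaWeight m (fun i => U i ω) j * X j ω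

/-- `U` is a random sample from the uniform distribution on `[0, 1]`, independent of the family
`X`. -/
structure IsUniformSampleIndepOf {Ω : Type*} [MeasurableSpace Ω] (P : Measure Ω) {n N : ℕ}
    (U : Fin N → Ω → ℝ) (X : Fin n → Ω → ℝ) : Prop where
  measurable : ∀ i, Measurable (U i)
  uniform : ∀ i, pdf.IsUniform (U i) (Set.Icc 0 1) P volume
  iIndep : iIndepFun U P
  indep : IndepFun (fun ω i => U i ω) (fun ω i => X i ω) P

/-- The measure on `[-1, 1]` with Lebesgue density `f`. -/
noncomputable def lawOfDensity (f : ℝ → ℝ) : Measure ℝ :=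
  (volume.restrict (Set.Icc (-1) 1)).withDensity (fun x => ENNReal.ofReal (f x))

/-- The arcsine distribution on `[-1, 1]`. -/
noncomputable def arcsineLaw : Measure ℝ :=
  lawOfDensity fun x => 1 / (Real.pi * √(1 - x ^ 2))

/-- The semicircle distribution on `[-1, 1]`. -/
noncomputable def semicircleLaw : Measure ℝ :=
  lawOfDensity fun x => 2 / Real.pi * √(1 - x ^ 2)

/-- The power semicircle distribution on `[-1, 1]` with exponent `5 / 2`. -/
noncomputable def powerSemicircleLaw52 : Measure ℝ :=
  lawOfDensity fun x => 16 / (5 * Real.pi) * (1 - x ^ 2) ^ (5 / 2 : ℝ)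

/-- The power semicircle distribution on `[-1, 1]` with exponent `3 / 2`. -/
noncomputable def powerSemicircleLaw32 : Measure ℝ :=
  lawOfDensity fun x => 8 / (3 * Real.pi) * (1 - x ^ 2) ^ (3 / 2 : ℝ)

/-! Every law involved lives on `[-1, 1]`, hence is determined by its moments, and the theorem
becomes one about moment sequences. Given the `X j`, the average is a sum of `N + 1` values (each `X
j` repeated as often as its multiplicity) weighted by the spacings of `N` uniform points. The
Hermite–Genocchi formula evaluates its moments as normalised complete homogeneous symmetric
polynomials, whose generating function is a product of geometric series. Integrating over the `X j`
gives, as formal power series, `∑ₖ (N + k choose N) E[Sᵏ] tᵏ = ∏ⱼ E[(1 - t X j)^(-m j)]`, which is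
`momentSeries_spacingAverage`.

For the arcsine law the ordinary moment series is `B = (1 - t²)^(-1/2)` (`mk_arcsine_sq`), and the
moments of the other laws are rational multiples of arcsine moments. Each forward implication is
then an identity between series, such as `B³` for the semicircle law with `d = 2` or `B⁵` with `d =
3`. For the converses, a nonzero factor is cancelled in (c) and (d), a cube root with constant term
1 is unique in (a) and (b), and in (e) the identity is integrated first, since `3 t² A² (tA)' =
((tA)³)'`. -/

/-! ### Laws on a compact interval are determined by moments. -/

/-- Finite measures on a compact interval are determined by their moments. -/
theorem measure_eq_of_moments_eq {a b : ℝ} {μ ν : Measure ℝ} [IsFiniteMeasure μ]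
    [IsFiniteMeasure ν] (hμ : ∀ᵐ x ∂μ, x ∈ Set.Icc a b) (hν : ∀ᵐ x ∂ν, x ∈ Set.Icc a b)
    (h : ∀ n : ℕ, ∫ x, x ^ n ∂μ = ∫ x, x ^ n ∂ν) : μ = ν := by
  have hint : ∀ (ρ : Measure ℝ) [IsFiniteMeasure ρ], (∀ᵐ x ∂ρ, x ∈ Set.Icc a b) →
      ∀ f : ℝ → ℝ, Continuous f → Integrable f ρ := by
    intro ρ _ hρ f hf
    obtain ⟨C, hC⟩ := (isCompact_Icc (a := a) (b := b)).exists_bound_of_continuousOn hf.continuousOn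
    refine Integrable.of_bound hf.aestronglyMeasurable C ?_
    filter_upwards [hρ] with x hx using hC x hx
  have hpoly : ∀ p : Polynomial ℝ, ∫ x, p.eval x ∂μ = ∫ x, p.eval x ∂ν := by
    intro p
    simp_rw [Polynomial.eval_eq_sum_range]
    rw [integral_finsetSum, integral_finsetSum]
    · simp_rw [integral_const_mul, h]
    · exact fun i _ => hint ν hν _ (by fun_prop)
    · exact fun i _ => hint μ hμ _ (by fun_prop)
  refine ext_of_forall_integral_eq_of_IsFiniteMeasure (μ := μ) (ν := ν) fun f => ?_
  have key : ∀ ε > 0, |∫ x, f x ∂μ - ∫ x, f x ∂ν| ≤ ε * (μ.real Set.univ + ν.real Set.univ) := by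
    intro ε hε
    obtain ⟨p, hp⟩ := exists_polynomial_near_of_continuousOn a b f f.continuous.continuousOn ε hε
    have bd : ∀ (ρ : Measure ℝ) [IsFiniteMeasure ρ], (∀ᵐ x ∂ρ, x ∈ Set.Icc a b) →
        |∫ x, f x ∂ρ - ∫ x, p.eval x ∂ρ| ≤ ε * ρ.real Set.univ := by
      intro ρ _ hρ
      rw [← integral_sub (hint ρ hρ _ f.continuous) (hint ρ hρ _ p.continuous)]
      rw [← Real.norm_eq_abs]
      refine norm_integral_le_of_norm_le_const ?_
      filter_upwards [hρ] with x hx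
      rw [Real.norm_eq_abs, abs_sub_comm]
      exact (hp x hx).le
    have h1 := abs_le.1 (bd μ hμ)
    have h2 := abs_le.1 (bd ν hν)
    have h3 := hpoly p
    rw [abs_le]
    constructor <;> nlinarith
  by_contra hne
  have hpos : 0 < |∫ x, f x ∂μ - ∫ x, f x ∂ν| := abs_pos.2 (sub_ne_zero.2 hne)
  set M := μ.real Set.univ + ν.real Set.univ
  have hM : 0 ≤ M := by positivity
  -- This `ε` makes the bound smaller than half the difference; the `+ 1` covers `M = 0`.
  have := key (|∫ x, f x ∂μ - ∫ x, f x ∂ν| / (2 * (M + 1))) (by positivity)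
  rw [div_mul_eq_mul_div, le_div_iff₀ (by positivity)] at this
  nlinarith

/-- A random variable with values in a compact interval has a given law on that interval iff it
has the moments of that law. -/
theorem hasLaw_iff_moments {Ω : Type*} [MeasurableSpace Ω] {P : Measure Ω}
    [IsProbabilityMeasure P] {a b : ℝ} {Y : Ω → ℝ} (hY : AEMeasurable Y P)
    (hYm : ∀ᵐ ω ∂P, Y ω ∈ Set.Icc a b) {ν : Measure ℝ} [IsFiniteMeasure ν]
    (hν : ∀ᵐ x ∂ν, x ∈ Set.Icc a b) :
    HasLaw Y ν P ↔ ∀ n : ℕ, ∫ ω, Y ω ^ n ∂P = ∫ x, x ^ n ∂ν := by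
  have hmap : ∀ n : ℕ, ∫ x, x ^ n ∂(P.map Y) = ∫ ω, Y ω ^ n ∂P := fun n =>
    integral_map hY (by fun_prop)
  constructor
  · intro h n
    rw [← hmap, h.map_eq]
  · intro h
    refine ⟨hY, ?_⟩
    have : IsFiniteMeasure (P.map Y) := by infer_instance
    refine measure_eq_of_moments_eq (a := a) (b := b) ?_ hν fun n => by rw [hmap, h]
    exact (ae_map_iff hY measurableSet_Icc).2 hYm

/-! ### Sorting a sample. -/

/-- On the closed set where `u ∘ σ` is monotone, sorting agrees with the fixed permutation `σ`, even
when there are ties; finitely many such sets cover the space. -/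
theorem measurable_comp_sort {N : ℕ} :
    Measurable fun u : Fin N → ℝ => u ∘ Tuple.sort u := by
  have hmon : ∀ σ : Equiv.Perm (Fin N), MeasurableSet {u : Fin N → ℝ | Monotone (u ∘ σ)} := by
    intro σ
    have : {u : Fin N → ℝ | Monotone (u ∘ σ)} =
        ⋂ i, ⋂ j, ⋂ _ : i ≤ j, {u : Fin N → ℝ | u (σ i) ≤ u (σ j)} := by
      ext u
      simp [Monotone]
    rw [this]
    exact MeasurableSet.iInter fun i => MeasurableSet.iInter fun j => MeasurableSet.iInter fun _ =>
      measurableSet_le (measurable_pi_apply _) (measurable_pi_apply _)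
  intro s hs
  have : (fun u : Fin N → ℝ => u ∘ Tuple.sort u) ⁻¹' s =
      ⋃ σ : Equiv.Perm (Fin N), {u | Monotone (u ∘ σ)} ∩ (fun u => u ∘ σ) ⁻¹' s := by
    ext u
    simp only [Set.mem_preimage, Set.mem_iUnion, Set.mem_inter_iff, Set.mem_ofPred_eq]
    constructor
    · exact fun h => ⟨Tuple.sort u, Tuple.monotone_sort u, h⟩
    · rintro ⟨σ, h1, h2⟩
      rwa [← Tuple.unique_monotone h1 (Tuple.monotone_sort u)]
  rw [this]
  refine MeasurableSet.iUnion fun σ => (hmon σ).inter ?_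
  exact (measurable_pi_iff.2 fun i => measurable_pi_apply (σ i)) hs

/-- A coincidence of two coordinates confines `u` to the kernel of a nonzero linear form, a null
set. -/
theorem ae_injective_volume (N : ℕ) : ∀ᵐ u : Fin N → ℝ, Function.Injective u := by
  have : ∀ i j : Fin N, i ≠ j → ∀ᵐ u : Fin N → ℝ, u i ≠ u j := by
    intro i j hij
    let L : (Fin N → ℝ) →ₗ[ℝ] ℝ :=
      LinearMap.proj (R := ℝ) (φ := fun _ => ℝ) i - LinearMap.proj (R := ℝ) (φ := fun _ => ℝ) j
    have h0 := Measure.addHaar_submodule volume (LinearMap.ker L) (by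
      intro h
      have : Pi.single i (1 : ℝ) ∈ LinearMap.ker L := by rw [h]; trivial
      simp [L, hij.symm] at this)
    rw [ae_iff]
    convert h0 using 2
    ext u
    simp [L, sub_eq_zero]
  have h2 : ∀ᵐ u : Fin N → ℝ, ∀ i j, i ≠ j → u i ≠ u j := by
    rw [ae_all_iff]
    intro i
    rw [ae_all_iff]
    intro j
    by_cases h : i = j
    · simp [h]
    · simpa [h] using this i j h
  filter_upwards [h2] with u hu i j hij
  by_contra h
  exact hu i j h hij

theorem isClosed_setOf_monotone_fin (N : ℕ) : IsClosed {w : Fin N → ℝ | Monotone w} :=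
  isClosed_monotone

/-- Averaging a function of the order statistics amounts to integrating over increasing tuples. -/
theorem integral_comp_sort {N : ℕ} (ν : Measure ℝ) [SigmaFinite ν]
    (hν : ∀ᵐ u ∂(Measure.pi fun _ : Fin N => ν), Function.Injective u)
    (F : (Fin N → ℝ) → ℝ)
    (hF : IntegrableOn F {w | Monotone w} (Measure.pi fun _ : Fin N => ν)) :
    ∫ u, F (u ∘ Tuple.sort u) ∂(Measure.pi fun _ : Fin N => ν) =
      N.factorial * ∫ w in {w | Monotone w}, F w ∂(Measure.pi fun _ : Fin N => ν) := by
  classical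
  set π := Measure.pi fun _ : Fin N => ν
  have hms : MeasurableSet {w : Fin N → ℝ | Monotone w} :=
    (isClosed_setOf_monotone_fin N).measurableSet
  set G := {w : Fin N → ℝ | Monotone w}.indicator F
  have hG : Integrable G π := (integrable_indicator_iff hms).2 hF
  -- For injective `u` exactly one permutation sorts it, so only one summand survives. All `N!`
  -- summands have the same integral, because the product measure is invariant under permutations.
  have hae : ∀ᵐ u ∂π, F (u ∘ Tuple.sort u) = ∑ σ : Equiv.Perm (Fin N), G (u ∘ σ) := by
    filter_upwards [hν] with u hu
    rw [Finset.sum_eq_single (Tuple.sort u)]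
    · exact (Set.indicator_of_mem (Tuple.monotone_sort u) F).symm
    · intro σ _ hσ
      refine Set.indicator_of_notMem (fun h => hσ ?_) F
      have := Tuple.unique_monotone h (Tuple.monotone_sort u)
      ext1 i
      exact hu (congrFun this i)
    · simp
  have hmp : ∀ σ : Equiv.Perm (Fin N), MeasurePreserving (fun u : Fin N → ℝ => u ∘ σ) π π := by
    intro σ
    have := measurePreserving_piCongrLeft (fun _ : Fin N => ν) σ.symm
    convert! this using 1
    ext u i
    have := Equiv.piCongrLeft_apply_apply (fun _ : Fin N => ℝ) σ.symm u (σ i)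
    simpa [MeasurableEquiv.coe_piCongrLeft] using this.symm
  have hemb : ∀ σ : Equiv.Perm (Fin N), MeasurableEmbedding (fun u : Fin N → ℝ => u ∘ σ) := by
    intro σ
    have := (MeasurableEquiv.piCongrLeft (fun _ : Fin N => ℝ) σ.symm).measurableEmbedding
    convert! this using 1
    ext u i
    have := Equiv.piCongrLeft_apply_apply (fun _ : Fin N => ℝ) σ.symm u (σ i)
    simpa [MeasurableEquiv.coe_piCongrLeft] using this.symm
  rw [integral_congr_ae hae, integral_finsetSum]
  · simp_rw [(hmp _).integral_comp (hemb _)]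
    rw [Finset.sum_const, Finset.card_univ, Fintype.card_perm, Fintype.card_fin, nsmul_eq_mul,
      integral_indicator hms]
  · exact fun σ _ => ((hmp σ).integrable_comp_emb (hemb σ)).2 hG

/-! ### The Hermite–Genocchi formula on the ordered simplex. -/

/-- `∫₀ᵛ tᵖ (v - t)^q dt = p! q! / (p + q + 1)! v^(p + q + 1)`. -/
theorem integral_pow_mul_sub_pow (v : ℝ) (p q : ℕ) :
    ∫ t in (0 : ℝ)..v, t ^ p * (v - t) ^ q =
      (p.factorial * q.factorial : ℝ) / (p + q + 1).factorial * v ^ (p + q + 1) := by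
  induction q generalizing p with
  | zero =>
    simp only [pow_zero, mul_one, integral_pow, Nat.factorial_zero, Nat.cast_one, add_zero]
    rw [Nat.factorial_succ, zero_pow (by omega)]
    push_cast
    have : (p.factorial : ℝ) ≠ 0 := by positivity
    have : (p : ℝ) + 1 ≠ 0 := by positivity
    field_simp
    ring
  | succ q ih =>
    -- Integration by parts: this function vanishes at `0` and `v`, which trades the exponents `(p,
    -- q + 1)` for `(p + 1, q)`.
    have hd : ∀ t : ℝ, HasDerivAt (fun t : ℝ => t ^ (p + 1) * (v - t) ^ (q + 1))
        ((p + 1) * (t ^ p * (v - t) ^ (q + 1)) - (q + 1) * (t ^ (p + 1) * (v - t) ^ q)) t := by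
      intro t
      have h1 := hasDerivAt_pow (p + 1) t
      have h2 := ((hasDerivAt_id t).const_sub v).pow (q + 1)
      convert! h1.mul h2 using 1
      simp
      ring
    have hF := intervalIntegral.integral_eq_sub_of_hasDerivAt (a := 0) (b := v)
      (fun t _ => hd t) (Continuous.intervalIntegrable (by fun_prop) _ _)
    rw [intervalIntegral.integral_sub (Continuous.intervalIntegrable (by fun_prop) _ _)
      (Continuous.intervalIntegrable (by fun_prop) _ _), intervalIntegral.integral_const_mul,
      intervalIntegral.integral_const_mul, ih (p + 1)] at hF
    simp only [ne_eq, Nat.succ_ne_zero, not_false_eq_true, zero_pow, sub_self, mul_zero, zero_mul]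
      at hF
    have e : p + 1 + q + 1 = p + (q + 1) + 1 := by ring
    rw [e, Nat.factorial_succ p] at hF
    rw [Nat.factorial_succ q]
    push_cast at hF ⊢
    have hp : (p : ℝ) + 1 ≠ 0 := by positivity
    apply mul_left_cancel₀ hp
    rw [sub_eq_zero.1 hF]
    ring

/-- The increasing `N`-tuples with entries in `[0, v]`. -/
def orderedTuples (N : ℕ) (v : ℝ) : Set (Fin N → ℝ) :=
  {w | Monotone w} ∩ Set.Icc 0 fun _ => v

theorem isCompact_orderedTuples (N : ℕ) (v : ℝ) : IsCompact (orderedTuples N v) :=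
  isCompact_Icc.inter_left (isClosed_setOf_monotone_fin N)

theorem measurableSet_orderedTuples (N : ℕ) (v : ℝ) : MeasurableSet (orderedTuples N v) :=
  (isCompact_orderedTuples N v).measurableSet

theorem mem_orderedTuples_succ {N : ℕ} {v : ℝ} {w : Fin (N + 1) → ℝ} :
    w ∈ orderedTuples (N + 1) v ↔ w (Fin.last N) ∈ Set.Icc 0 v ∧
      (fun i : Fin N => w i.castSucc) ∈ orderedTuples N (w (Fin.last N)) := by
  simp only [orderedTuples, Set.mem_inter_iff, Set.mem_ofPred_eq, Set.mem_Icc, Pi.le_def,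
    Pi.zero_apply]
  constructor
  · rintro ⟨hm, h0, hv⟩
    exact ⟨⟨h0 _, hv _⟩, fun i j hij => hm (Fin.castSucc_le_castSucc_iff.2 hij),
      fun i => h0 _, fun i => hm (Fin.le_last _)⟩
  · rintro ⟨⟨h0, hv⟩, hm, h0', hv'⟩
    refine ⟨fun i j hij => ?_, fun i => ?_, fun i => ?_⟩
    · induction j using Fin.lastCases with
      | last =>
        induction i using Fin.lastCases with
        | last => exact le_rfl
        | cast i => exact hv' i
      | cast j =>
        induction i using Fin.lastCases with
        | last => exact absurd hij (by simp [Fin.le_def])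
        | cast i => exact hm (Fin.castSucc_le_castSucc_iff.1 hij)
    · induction i using Fin.lastCases with
      | last => exact h0
      | cast i => exact h0' i
    · induction i using Fin.lastCases with
      | last => exact hv
      | cast i => exact (hv' i).trans hv

/-- Fubini with the largest entry as outer variable: the remaining entries form an ordered tuple
bounded by it. This drives the induction on `N`. -/
theorem setIntegral_orderedTuples_succ (N : ℕ) (v : ℝ) (g : ℝ × (Fin N → ℝ) → ℝ)
    (hg : Continuous g) :
    ∫ w in orderedTuples (N + 1) v, g (w (Fin.last N), fun i => w i.castSucc) =
      ∫ t in Set.Icc 0 v, ∫ w in orderedTuples N t, g (t, w) := by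
  set e := MeasurableEquiv.piFinSuccAbove (fun _ : Fin (N + 1) => ℝ) (Fin.last N)
  have he : ∀ w, e w = (w (Fin.last N), fun i => w i.castSucc) := by
    intro w
    ext i
    · rfl
    · simp [e, MeasurableEquiv.piFinSuccAbove, Fin.insertNthEquiv, Fin.init]
  have hmp : MeasurePreserving e := volume_preserving_piFinSuccAbove _ _
  set E : Set (ℝ × (Fin N → ℝ)) := {z | z.1 ∈ Set.Icc 0 v ∧ z.2 ∈ orderedTuples N z.1}
  have hE : e ⁻¹' E = orderedTuples (N + 1) v := by
    ext w
    simp only [Set.mem_preimage, he]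
    exact mem_orderedTuples_succ.symm
  have hEm : MeasurableSet E := by
    rw [← e.measurableSet_preimage, hE]
    exact measurableSet_orderedTuples _ _
  -- Integrability is pulled back along `e`, where the domain is the compact set of ordered tuples
  -- and the integrand is continuous.
  have hint : Integrable (E.indicator g) := by
    rw [← hmp.integrable_comp_emb e.measurableEmbedding, show E.indicator g ∘ e = (e ⁻¹' E).indicator (g ∘ e) from
      funext fun _ => (Set.indicator_comp_right _).symm, hE,
      integrable_indicator_iff (measurableSet_orderedTuples _ _)]
    refine ContinuousOn.integrableOn_compact (isCompact_orderedTuples _ _) ?_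
    refine (hg.comp ?_).continuousOn
    have : (e : (Fin (N + 1) → ℝ) → _) = fun w => (w (Fin.last N), fun i => w i.castSucc) :=
      funext he
    rw [this]
    fun_prop
  calc ∫ w in orderedTuples (N + 1) v, g (w (Fin.last N), fun i => w i.castSucc)
      = ∫ w in e ⁻¹' E, g (e w) := by rw [hE]; simp_rw [he]
    _ = ∫ z in E, g z := hmp.setIntegral_preimage_emb e.measurableEmbedding _ _
    _ = ∫ z, E.indicator g z := (integral_indicator hEm).symm
    _ = ∫ t, ∫ w, E.indicator g (t, w) := integral_prod _ hint
    _ = ∫ t, (Set.Icc 0 v).indicator (fun t => ∫ w in orderedTuples N t, g (t, w)) t := by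
      refine integral_congr_ae (Filter.Eventually.of_forall fun t => ?_)
      by_cases ht : t ∈ Set.Icc 0 v
      · simp only [Set.indicator_of_mem ht]
        rw [← integral_indicator (measurableSet_orderedTuples _ _)]
        congr 1
        ext w
        by_cases hw : w ∈ orderedTuples N t
        · rw [Set.indicator_of_mem hw, Set.indicator_of_mem (show (t, w) ∈ E from ⟨ht, hw⟩)]
        · rw [Set.indicator_of_notMem hw,
            Set.indicator_of_notMem (show (t, w) ∉ E from fun h => hw h.2)]
      · simp only [Set.indicator_of_notMem ht]
        have : ∀ w, E.indicator g (t, w) = 0 := fun w =>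
          Set.indicator_of_notMem (fun h => ht h.1) _
        simp [this]
    _ = _ := integral_indicator measurableSet_Icc

/-- The sum of `y 0, …, y N` weighted by the spacings of `0, w 0, …, w (N - 1), v`. -/
def spacingSum (y : ℕ → ℝ) : (N : ℕ) → ℝ → (Fin N → ℝ) → ℝ
  | 0, v, _ => v * y 0
  | N + 1, v, w =>
    spacingSum y N (w (Fin.last N)) (fun i => w i.castSucc) + (v - w (Fin.last N)) * y (N + 1)

theorem continuous_spacingSum (N : ℕ) :
    Continuous fun z : (ℕ → ℝ) × ℝ × (Fin N → ℝ) => spacingSum z.1 N z.2.1 z.2.2 := by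
  induction N with
  | zero => simp only [spacingSum]; fun_prop
  | succ N ih =>
    simp only [spacingSum]
    refine Continuous.add ?_ (by fun_prop)
    exact ih.comp (g := fun z : (ℕ → ℝ) × ℝ × (Fin N → ℝ) => spacingSum z.1 N z.2.1 z.2.2)
      (f := fun z : (ℕ → ℝ) × ℝ × (Fin (N + 1) → ℝ) =>
        (z.1, z.2.2 (Fin.last N), fun i => z.2.2 i.castSucc)) (by fun_prop)

/-- The spacings are nonnegative and telescope to `v`. -/
theorem abs_spacingSum_le {y : ℕ → ℝ} (hy : ∀ i, |y i| ≤ 1) {N : ℕ} {v : ℝ} (hv : 0 ≤ v)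
    {w : Fin N → ℝ} (hw : w ∈ orderedTuples N v) : |spacingSum y N v w| ≤ v := by
  induction N generalizing v with
  | zero =>
    rw [spacingSum, abs_mul, abs_of_nonneg hv]
    exact mul_le_of_le_one_right hv (hy 0)
  | succ N ih =>
    rw [mem_orderedTuples_succ] at hw
    have h1 := ih hw.1.1 hw.2
    have h2 : |(v - w (Fin.last N)) * y (N + 1)| ≤ v - w (Fin.last N) := by
      rw [abs_mul, abs_of_nonneg (sub_nonneg.2 hw.1.2)]
      exact mul_le_of_le_one_right (sub_nonneg.2 hw.1.2) (hy _)
    rw [spacingSum]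
    calc _ ≤ _ := abs_add_le _ _
      _ ≤ w (Fin.last N) + (v - w (Fin.last N)) := add_le_add h1 h2
      _ = v := by ring

/-- The Hermite–Genocchi formula for monomials: the integral over the ordered simplex is a
complete homogeneous symmetric polynomial. -/
theorem setIntegral_spacingSum_pow (y : ℕ → ℝ) (N k : ℕ) {v : ℝ} (hv : 0 ≤ v) :
    ∫ w in orderedTuples N v, spacingSum y N v w ^ k =
      (k.factorial : ℝ) / (N + k).factorial * v ^ (N + k) *
        PowerSeries.coeff k (∏ i ∈ Finset.range (N + 1), PowerSeries.mk fun n => y i ^ n) := by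
  induction N generalizing v k with
  | zero =>
    have : orderedTuples 0 v = Set.univ := by
      ext w
      simp only [orderedTuples, Set.mem_inter_iff, Set.mem_ofPred_eq, Set.mem_Icc, Set.mem_univ,
        iff_true]
      exact ⟨fun i => i.elim0, fun i => i.elim0, fun i => i.elim0⟩
    have hk : (k.factorial : ℝ) ≠ 0 := by positivity
    simp [this, spacingSum, mul_pow, hk, Measure.real, volume_pi]
  | succ N ih =>
    have hcont : ∀ t : ℝ, Continuous fun w : Fin N → ℝ => spacingSum y N t w := fun t =>
      (continuous_spacingSum N).comp (f := fun w => (y, t, w)) (by fun_prop)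
    simp_rw [spacingSum]
    have h1 := setIntegral_orderedTuples_succ N v
      (fun z => (spacingSum y N z.1 z.2 + (v - z.1) * y (N + 1)) ^ k) (by
        have := (continuous_spacingSum N).comp
          (f := fun z : ℝ × (Fin N → ℝ) => (y, z.1, z.2)) (by fun_prop)
        simp only [Function.comp_def] at this
        fun_prop)
    simp only at h1
    rw [h1]
    -- The last summand is split off by the binomial theorem. The inner integrals come from the
    -- induction hypothesis, the outer ones are Beta integrals, and the sum over `m` is the Cauchy
    -- product with the new geometric series.
    have h2 : ∀ t ∈ Set.Icc 0 v,
        ∫ w in orderedTuples N t, (spacingSum y N t w + (v - t) * y (N + 1)) ^ k =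
        ∑ m ∈ Finset.HasAntidiagonal.antidiagonal k, (k.choose m.1 * (m.1.factorial : ℝ) / (N + m.1).factorial *
          PowerSeries.coeff m.1 (∏ i ∈ Finset.range (N + 1), PowerSeries.mk fun n => y i ^ n) *
          y (N + 1) ^ m.2) * (t ^ (N + m.1) * (v - t) ^ m.2) := by
      intro t ht
      simp_rw [(Commute.all (_ : ℝ) _).add_pow']
      rw [integral_finsetSum]
      · refine Finset.sum_congr rfl fun m _ => ?_
        simp_rw [nsmul_eq_mul]
        rw [integral_const_mul, integral_mul_const, ih m.1 ht.1, mul_pow]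
        ring
      · intro m _
        refine ContinuousOn.integrableOn_compact (isCompact_orderedTuples _ _) ?_
        have := hcont t
        exact Continuous.continuousOn (by fun_prop)
    rw [setIntegral_congr_fun measurableSet_Icc h2, integral_Icc_eq_integral_Ioc,
      ← intervalIntegral.integral_of_le hv, intervalIntegral.integral_finsetSum
        fun m _ => Continuous.intervalIntegrable (by fun_prop) _ _]
    simp_rw [intervalIntegral.integral_const_mul, integral_pow_mul_sub_pow]
    rw [Finset.prod_range_succ _ (N + 1), PowerSeries.coeff_mul, Finset.mul_sum]
    refine Finset.sum_congr rfl fun m hm => ?_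
    have hk : m.1 + m.2 = k := Finset.HasAntidiagonal.mem_antidiagonal.1 hm
    have e : N + m.1 + m.2 + 1 = N + 1 + k := by omega
    rw [e, PowerSeries.coeff_mk]
    have hc : (k.choose m.1 : ℝ) * m.1.factorial * m.2.factorial = k.factorial := by
      rw [← hk, Nat.choose_symm_add]
      exact_mod_cast Nat.add_choose_mul_factorial_mul_factorial m.1 m.2
    rw [← hc]
    have : ((N + m.1).factorial : ℝ) ≠ 0 := by positivity
    have : ((N + 1 + k).factorial : ℝ) ≠ 0 := by positivity
    field_simp

/-! ### The moment identity for randomly weighted averages. -/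

/-- The series `∑ₙ (n + d choose d) aₙ tⁿ`, the formal version of `E[(1 - t X)^(-(d + 1))]` when
`a` is the sequence of moments of `X`. -/
noncomputable def momentSeries (d : ℕ) (a : ℕ → ℝ) : PowerSeries ℝ :=
  PowerSeries.mk fun n => ((n + d).choose d : ℝ) * a n

/-- This is the negative binomial series for `(1 - x t)^(-(d + 1))`, obtained by rescaling the case
`x = 1`. -/
theorem mk_pow_pow_succ (x : ℝ) (d : ℕ) :
    (PowerSeries.mk fun n => x ^ n) ^ (d + 1) = momentSeries d fun n => x ^ n := by
  have h : (PowerSeries.mk fun n => x ^ n) = PowerSeries.rescale x (PowerSeries.mk 1) := by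
    ext n
    simp [PowerSeries.coeff_rescale]
  rw [h, ← map_pow, PowerSeries.mk_one_pow_eq_mk_choose_add]
  ext n
  simp [PowerSeries.coeff_rescale, momentSeries, add_comm, mul_comm]

/-- Under independence, the expectation of a product of geometric series factors. -/
theorem integral_coeff_prod_momentSeries {Ω : Type*} [MeasurableSpace Ω] {P : Measure Ω} {n : ℕ}
    {X : Fin n → Ω → ℝ} (hX : ∀ i, Measurable (X i)) (hind : iIndepFun X P)
    (hint : ∀ l : Fin n → ℕ, Integrable (fun ω => ∏ j, X j ω ^ l j) P) (d : Fin n → ℕ) (k : ℕ) :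
    ∫ ω, PowerSeries.coeff k (∏ j, momentSeries (d j) fun n => X j ω ^ n) ∂P =
      PowerSeries.coeff k (∏ j, momentSeries (d j) fun n => ∫ ω, X j ω ^ n ∂P) := by
  simp only [PowerSeries.coeff_prod, momentSeries, PowerSeries.coeff_mk, Finset.prod_mul_distrib]
  rw [integral_finsetSum]
  · refine Finset.sum_congr rfl fun l _ => ?_
    rw [integral_const_mul]
    congr 1
    exact hind.integral_fun_prod_comp (f := fun j x => x ^ l j) (fun i => (hX i).aemeasurable)
      fun i => by fun_prop
  · exact fun l _ => (hint l).const_mul _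

theorem map_uniformSample {Ω : Type*} [MeasurableSpace Ω] {P : Measure Ω} [IsProbabilityMeasure P]
    {n N : ℕ} {U : Fin N → Ω → ℝ} {X : Fin n → Ω → ℝ} (h : IsUniformSampleIndepOf P U X) :
    P.map (fun ω i => U i ω) = Measure.pi fun _ => volume.restrict (Set.Icc 0 1) := by
  rw [h.iIndep.map_fun_eq_pi_map fun i => (h.measurable i).aemeasurable]
  congr 1
  ext1 i
  rw [h.uniform i, ProbabilityTheory.cond]
  simp

theorem pi_restrict_Icc (N : ℕ) :
    (Measure.pi fun _ : Fin N => (volume : Measure ℝ).restrict (Set.Icc 0 1)) =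
      volume.restrict (Set.Icc 0 fun _ => 1) := by
  rw [volume_pi, ← Measure.restrict_pi_pi, Set.pi_univ_Icc]
  rfl

/-- The average of `X (b 0), …, X (b N)` weighted by the spacings of the sample `U`. -/
noncomputable def spacingAverage {Ω : Type*} {n N : ℕ} (b : ℕ → Fin n) (U : Fin N → Ω → ℝ)
    (X : Fin n → Ω → ℝ) (ω : Ω) : ℝ :=
  spacingSum (fun i => X (b i) ω) N 1 ((fun i => U i ω) ∘ Tuple.sort fun i => U i ω)

theorem measurable_spacingSum_sort (N n : ℕ) (b : ℕ → Fin n) :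
    Measurable fun z : (Fin N → ℝ) × (Fin n → ℝ) =>
      spacingSum (fun i => z.2 (b i)) N 1 (z.1 ∘ Tuple.sort z.1) := by
  have h := (continuous_spacingSum N).comp
    (f := fun z : (Fin N → ℝ) × (Fin n → ℝ) => (fun i => z.2 (b i), 1, z.1)) (by fun_prop)
  exact h.measurable.comp (g := fun z : (Fin N → ℝ) × (Fin n → ℝ) =>
    spacingSum (fun i => z.2 (b i)) N 1 z.1)
    ((measurable_comp_sort.comp measurable_fst).prodMk measurable_snd)

section

variable {Ω : Type*} [MeasurableSpace Ω] {P : Measure Ω} {n N : ℕ}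
  {U : Fin N → Ω → ℝ} {X : Fin n → Ω → ℝ}

theorem measurable_spacingAverage (b : ℕ → Fin n) (h : IsUniformSampleIndepOf P U X)
    (hX : ∀ i, Measurable (X i)) : Measurable (spacingAverage b U X) :=
  (measurable_spacingSum_sort N n b).comp (f := fun ω => (fun i => U i ω, fun i => X i ω))
    ((measurable_pi_iff.2 h.measurable).prodMk (measurable_pi_iff.2 hX))

variable [IsProbabilityMeasure P]

theorem spacingAverage_mem_Icc (b : ℕ → Fin n) (h : IsUniformSampleIndepOf P U X)
    (hXm : ∀ i, ∀ᵐ ω ∂P, X i ω ∈ Set.Icc (-1 : ℝ) 1) :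
    ∀ᵐ ω ∂P, spacingAverage b U X ω ∈ Set.Icc (-1 : ℝ) 1 := by
  have hU : ∀ᵐ ω ∂P, (fun i => U i ω) ∈ Set.Icc (0 : Fin N → ℝ) fun _ => 1 := by
    refine ae_of_ae_map (f := fun ω i => U i ω) (p := (· ∈ Set.Icc (0 : Fin N → ℝ) fun _ => 1))
      (measurable_pi_iff.2 h.measurable).aemeasurable ?_
    rw [map_uniformSample h, pi_restrict_Icc]
    exact ae_restrict_mem measurableSet_Icc
  filter_upwards [hU, ae_all_iff.2 hXm] with ω hω hx
  rw [Set.mem_Icc, ← abs_le]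
  refine abs_spacingSum_le (fun i => abs_le.2 (hx (b i))) zero_le_one ⟨Tuple.monotone_sort _, ?_⟩
  exact ⟨fun i => hω.1 (Tuple.sort (fun j => U j ω) i), fun i => hω.2 (Tuple.sort (fun j => U j ω) i)⟩

/-- The factor `N!` counts the orderings of the sample. The resulting constant is the inverse of the
binomial coefficient in `momentSeries N`. -/
theorem integral_spacingSum_sort_pow (y : ℕ → ℝ) (N k : ℕ) :
    ∫ u, spacingSum y N 1 (u ∘ Tuple.sort u) ^ k
        ∂(Measure.pi fun _ : Fin N => (volume : Measure ℝ).restrict (Set.Icc 0 1)) =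
      (N.factorial * k.factorial : ℝ) / (N + k).factorial *
        PowerSeries.coeff k (∏ i ∈ Finset.range (N + 1), PowerSeries.mk fun n => y i ^ n) := by
  have hms : MeasurableSet {w : Fin N → ℝ | Monotone w} :=
    (isClosed_setOf_monotone_fin N).measurableSet
  have hr : (Measure.pi fun _ : Fin N => (volume : Measure ℝ).restrict (Set.Icc 0 1)).restrict
      {w | Monotone w} = volume.restrict (orderedTuples N 1) := by
    rw [pi_restrict_Icc, Measure.restrict_restrict hms]
    rfl
  rw [integral_comp_sort _ _ fun w => spacingSum y N 1 w ^ k, hr,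
    setIntegral_spacingSum_pow y N k zero_le_one]
  · ring
  · rw [IntegrableOn, hr]
    refine ContinuousOn.integrableOn_compact (isCompact_orderedTuples _ _) ?_
    have := (continuous_spacingSum N).comp (f := fun w : Fin N → ℝ => (y, 1, w)) (by fun_prop)
    exact (this.pow k).continuousOn
  · rw [pi_restrict_Icc]
    exact ae_restrict_of_ae (ae_injective_volume N)

/-- The moments of the randomly weighted average in terms of those of the `X j`. -/
theorem momentSeries_spacingAverage (b : ℕ → Fin n) (h : IsUniformSampleIndepOf P U X)
    (hX : ∀ i, Measurable (X i)) (hXm : ∀ i, ∀ᵐ ω ∂P, X i ω ∈ Set.Icc (-1 : ℝ) 1)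
    (hind : iIndepFun X P) (d : Fin n → ℕ)
    (hb : ∀ f : Fin n → PowerSeries ℝ,
      ∏ i ∈ Finset.range (N + 1), f (b i) = ∏ j, f j ^ (d j + 1)) :
    momentSeries N (fun k => ∫ ω, spacingAverage b U X ω ^ k ∂P) =
      ∏ j, momentSeries (d j) fun k => ∫ ω, X j ω ^ k ∂P := by
  have hint : ∀ l : Fin n → ℕ, Integrable (fun ω => ∏ j, X j ω ^ l j) P := by
    intro l
    refine Integrable.of_bound (Finset.measurable_fun_prod _
      fun j _ => (hX j).pow_const _).aestronglyMeasurable 1 ?_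
    filter_upwards [ae_all_iff.2 hXm] with ω hω
    rw [norm_prod]
    refine Finset.prod_le_one (fun _ _ => norm_nonneg _) fun j _ => ?_
    rw [norm_pow]
    exact pow_le_one₀ (norm_nonneg _) (abs_le.2 (hω j))
  have hUm : Measurable fun ω i => U i ω := measurable_pi_iff.2 h.measurable
  have hXM : Measurable fun ω i => X i ω := measurable_pi_iff.2 hX
  ext k
  rw [← integral_coeff_prod_momentSeries hX hind hint, momentSeries, PowerSeries.coeff_mk]
  have hT : ∫ ω, spacingAverage b U X ω ^ k ∂P =
      ∫ ω, ((N.factorial * k.factorial : ℝ) / (N + k).factorial *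
        PowerSeries.coeff k (∏ j, momentSeries (d j) fun n => X j ω ^ n)) ∂P := by
    set F : (Fin N → ℝ) × (Fin n → ℝ) → ℝ := fun z =>
      spacingSum (fun i => z.2 (b i)) N 1 (z.1 ∘ Tuple.sort z.1) ^ k
    have hF : Measurable F := (measurable_spacingSum_sort N n b).pow_const k
    have hprod := (indepFun_iff_map_prod_eq_prod_map_map hUm.aemeasurable hXM.aemeasurable).1 h.indep
    have hFi : Integrable F (P.map fun ω => (fun i => U i ω, fun i => X i ω)) := by
      rw [integrable_map_measure hF.aestronglyMeasurable (hUm.prodMk hXM).aemeasurable]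
      refine Integrable.of_bound
        (hF.comp (hUm.prodMk hXM)).aestronglyMeasurable 1 ?_
      filter_upwards [spacingAverage_mem_Icc b h hXm] with ω hω
      exact (norm_pow _ _).trans_le (pow_le_one₀ (norm_nonneg _) (abs_le.2 hω))
    -- By independence, `U` may be integrated out first with the values of `X` frozen at `x`.
    have hinner : ∀ x : Fin n → ℝ,
        ∫ u, F (u, x) ∂(P.map fun ω i => U i ω) = (N.factorial * k.factorial : ℝ) /
          (N + k).factorial * PowerSeries.coeff k (∏ j, momentSeries (d j) fun n => x j ^ n) := by
      intro x
      rw [map_uniformSample h]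
      refine (integral_spacingSum_sort_pow (fun i => x (b i)) N k).trans ?_
      -- `hb` encodes that `b` takes the value `j` exactly `d j + 1` times among `0, …, N`; equal
      -- geometric series are collected into a power.
      rw [hb fun j => PowerSeries.mk fun n => x j ^ n]
      simp_rw [mk_pow_pow_succ]
    have hmeas : Measurable fun x : Fin n → ℝ => ((N.factorial * k.factorial : ℝ) /
          (N + k).factorial * PowerSeries.coeff k (∏ j, momentSeries (d j) fun n => x j ^ n)) := by
      simp only [PowerSeries.coeff_prod, momentSeries, PowerSeries.coeff_mk]
      fun_prop
    calc ∫ ω, spacingAverage b U X ω ^ k ∂P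
        = ∫ z, F z ∂(P.map fun ω => (fun i => U i ω, fun i => X i ω)) :=
          (integral_map (hUm.prodMk hXM).aemeasurable hF.aestronglyMeasurable).symm
      _ = ∫ x, ∫ u, F (u, x) ∂(P.map fun ω i => U i ω) ∂(P.map fun ω i => X i ω) := by
          rw [hprod] at hFi ⊢
          exact integral_prod_symm F hFi
      _ = _ := by
          simp_rw [hinner]
          exact integral_map hXM.aemeasurable hmeas.aestronglyMeasurable
  rw [hT, integral_const_mul, ← mul_assoc]
  have hc : ((k + N).choose N : ℝ) * ((N.factorial * k.factorial : ℝ) / (N + k).factorial) = 1 := by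
    have : ((k + N).choose N : ℝ) * (N.factorial * k.factorial) = (N + k).factorial := by
      rw [add_comm N k, ← Nat.add_choose_mul_factorial_mul_factorial k N]
      push_cast
      ring
    rw [mul_div_assoc', this, div_self (by positivity)]
  rw [hc, one_mul]

end

/-! ### Moments of the four laws through the substitution `x = sin θ`. -/

/-- The moments of the arcsine distribution. -/
noncomputable def arcsineMoment (n : ℕ) : ℝ :=
  (∫ θ in (-(Real.pi / 2))..(Real.pi / 2), Real.sin θ ^ n) / Real.pi

theorem arcsineMoment_zero : arcsineMoment 0 = 1 := by
  have := Real.pi_ne_zero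
  simp [arcsineMoment]

theorem arcsineMoment_one : arcsineMoment 1 = 0 := by
  simp [arcsineMoment]

/-- Wallis recursion: the boundary terms contain `cos (±π/2) = 0`. -/
theorem arcsineMoment_add_two (n : ℕ) :
    arcsineMoment (n + 2) = (n + 1) / (n + 2) * arcsineMoment n := by
  simp only [arcsineMoment, integral_sin_pow, Real.cos_neg, Real.cos_pi_div_two]
  ring

theorem image_sin_Ioo : Real.sin '' Set.Ioo (-(Real.pi / 2)) (Real.pi / 2) = Set.Ioo (-1) 1 :=
  Real.sinPartialHomeomorph.image_source_eq_target

section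

variable {f q : ℝ → ℝ}

/-- After `x = sin θ` the Jacobian `cos θ` absorbs the endpoint singularity and leaves the
continuous integrand `q (sin θ)`. The interval is open because the relation fails at `±π/2` for the
arcsine density. -/
theorem isFiniteMeasure_lawOfDensity (hq : Continuous q)
    (h : ∀ θ ∈ Set.Ioo (-(Real.pi / 2)) (Real.pi / 2), Real.cos θ * f (Real.sin θ) =
      q (Real.sin θ)) : IsFiniteMeasure (lawOfDensity f) := by
  refine isFiniteMeasure_withDensity_ofReal (Integrable.hasFiniteIntegral ?_)
  rw [← IntegrableOn, integrableOn_Icc_iff_integrableOn_Ioo, ← image_sin_Ioo,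
    integrableOn_image_iff_integrableOn_abs_deriv_smul measurableSet_Ioo
      (fun θ _ => (Real.hasDerivAt_sin θ).hasDerivWithinAt)
      (Real.injOn_sin.mono Set.Ioo_subset_Icc_self)]
  have hc : IntegrableOn (fun θ => q (Real.sin θ)) (Set.Ioo (-(Real.pi / 2)) (Real.pi / 2)) :=
    (hq.comp Real.continuous_sin).integrableOn_Icc.mono_set Set.Ioo_subset_Icc_self
  refine hc.congr_fun (fun θ hθ => ?_) measurableSet_Ioo
  simp only [smul_eq_mul]
  rw [abs_of_pos (Real.cos_pos_of_mem_Ioo hθ), h θ hθ]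

theorem lawOfDensity_mem_Icc (f : ℝ → ℝ) : ∀ᵐ x ∂(lawOfDensity f), x ∈ Set.Icc (-1 : ℝ) 1 :=
  (withDensity_absolutelyContinuous _ _).ae_le (ae_restrict_mem measurableSet_Icc)

theorem integral_pow_lawOfDensity (hf : Measurable f) (hf0 : ∀ x ∈ Set.Icc (-1 : ℝ) 1, 0 ≤ f x)
    (h : ∀ θ ∈ Set.Ioo (-(Real.pi / 2)) (Real.pi / 2), Real.cos θ * f (Real.sin θ) =
      q (Real.sin θ)) (n : ℕ) :
    ∫ x, x ^ n ∂(lawOfDensity f) =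
      ∫ θ in (-(Real.pi / 2))..(Real.pi / 2), q (Real.sin θ) * Real.sin θ ^ n := by
  rw [lawOfDensity, integral_withDensity_eq_integral_toReal_smul hf.ennreal_ofReal (by simp),
    setIntegral_congr_fun measurableSet_Icc fun x hx => by
      rw [ENNReal.toReal_ofReal (hf0 x hx)],
    integral_Icc_eq_integral_Ioo, ← image_sin_Ioo,
    integral_image_eq_integral_abs_deriv_smul measurableSet_Ioo
      (fun θ _ => (Real.hasDerivAt_sin θ).hasDerivWithinAt)
      (Real.injOn_sin.mono Set.Ioo_subset_Icc_self),
    intervalIntegral.integral_of_le (by linarith [Real.pi_pos]), integral_Ioc_eq_integral_Ioo]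
  refine setIntegral_congr_fun measurableSet_Ioo fun θ hθ => ?_
  simp only [smul_eq_mul]
  rw [abs_of_pos (Real.cos_pos_of_mem_Ioo hθ), ← mul_assoc, h θ hθ]

end

theorem sqrt_one_sub_sin_sq {θ : ℝ} (hθ : θ ∈ Set.Ioo (-(Real.pi / 2)) (Real.pi / 2)) :
    √(1 - Real.sin θ ^ 2) = Real.cos θ := by
  rw [← Real.cos_sq', Real.sqrt_sq (Real.cos_pos_of_mem_Ioo hθ).le]

theorem cos_mul_arcsine_density {θ : ℝ} (hθ : θ ∈ Set.Ioo (-(Real.pi / 2)) (Real.pi / 2)) :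
    Real.cos θ * (1 / (Real.pi * √(1 - Real.sin θ ^ 2))) = 1 / Real.pi := by
  have := Real.pi_ne_zero
  have := (Real.cos_pos_of_mem_Ioo hθ).ne'
  rw [sqrt_one_sub_sin_sq hθ]
  field_simp

theorem cos_mul_semicircle_density {θ : ℝ} (hθ : θ ∈ Set.Ioo (-(Real.pi / 2)) (Real.pi / 2)) :
    Real.cos θ * (2 / Real.pi * √(1 - Real.sin θ ^ 2)) =
      2 / Real.pi * (1 - Real.sin θ ^ 2) := by
  rw [sqrt_one_sub_sin_sq hθ, ← Real.cos_sq']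
  ring

theorem one_sub_sin_sq_rpow {θ : ℝ} (hθ : θ ∈ Set.Ioo (-(Real.pi / 2)) (Real.pi / 2)) (k : ℕ) :
    (1 - Real.sin θ ^ 2) ^ ((k : ℝ) / 2) = Real.cos θ ^ k := by
  rw [← sqrt_one_sub_sin_sq hθ, Real.sqrt_eq_rpow, ← Real.rpow_mul_natCast]
  · congr 1
    ring
  · rw [← Real.cos_sq']
    positivity

theorem cos_mul_powerSemicircle32_density {θ : ℝ}
    (hθ : θ ∈ Set.Ioo (-(Real.pi / 2)) (Real.pi / 2)) :
    Real.cos θ * (8 / (3 * Real.pi) * (1 - Real.sin θ ^ 2) ^ (3 / 2 : ℝ)) =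
      8 / (3 * Real.pi) * (1 - Real.sin θ ^ 2) ^ 2 := by
  have := one_sub_sin_sq_rpow hθ 3
  push_cast at this
  rw [this, ← Real.cos_sq']
  ring

theorem cos_mul_powerSemicircle52_density {θ : ℝ}
    (hθ : θ ∈ Set.Ioo (-(Real.pi / 2)) (Real.pi / 2)) :
    Real.cos θ * (16 / (5 * Real.pi) * (1 - Real.sin θ ^ 2) ^ (5 / 2 : ℝ)) =
      16 / (5 * Real.pi) * (1 - Real.sin θ ^ 2) ^ 3 := by
  have := one_sub_sin_sq_rpow hθ 5
  push_cast at this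
  rw [this, ← Real.cos_sq']
  ring

instance : IsFiniteMeasure arcsineLaw :=
  isFiniteMeasure_lawOfDensity (q := fun _ => 1 / Real.pi) (by fun_prop)
    fun _ => cos_mul_arcsine_density

instance : IsFiniteMeasure semicircleLaw :=
  isFiniteMeasure_lawOfDensity (q := fun s => 2 / Real.pi * (1 - s ^ 2)) (by fun_prop)
    fun _ => cos_mul_semicircle_density

instance : IsFiniteMeasure powerSemicircleLaw32 :=
  isFiniteMeasure_lawOfDensity (q := fun s => 8 / (3 * Real.pi) * (1 - s ^ 2) ^ 2) (by fun_prop)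
    fun _ => cos_mul_powerSemicircle32_density

instance : IsFiniteMeasure powerSemicircleLaw52 :=
  isFiniteMeasure_lawOfDensity (q := fun s => 16 / (5 * Real.pi) * (1 - s ^ 2) ^ 3) (by fun_prop)
    fun _ => cos_mul_powerSemicircle52_density

theorem one_sub_sq_nonneg {x : ℝ} (hx : x ∈ Set.Icc (-1 : ℝ) 1) : 0 ≤ 1 - x ^ 2 :=
  sub_nonneg.2 ((sq_le_one_iff_abs_le_one x).2 (abs_le.2 hx))

theorem integral_pow_arcsineLaw (n : ℕ) : ∫ x, x ^ n ∂arcsineLaw = arcsineMoment n := by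
  rw [arcsineLaw, integral_pow_lawOfDensity (q := fun _ => 1 / Real.pi) (by fun_prop)
    (fun x _ => by positivity) fun _ => cos_mul_arcsine_density,
    intervalIntegral.integral_const_mul, arcsineMoment]
  ring

theorem integral_pow_semicircleLaw (n : ℕ) :
    ∫ x, x ^ n ∂semicircleLaw = 2 * (arcsineMoment n - arcsineMoment (n + 2)) := by
  rw [semicircleLaw, integral_pow_lawOfDensity (q := fun s => 2 / Real.pi * (1 - s ^ 2))
    (by fun_prop) (fun x _ => by positivity) fun _ => cos_mul_semicircle_density]
  have : ∀ θ : ℝ, 2 / Real.pi * (1 - Real.sin θ ^ 2) * Real.sin θ ^ n =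
      2 / Real.pi * (Real.sin θ ^ n - Real.sin θ ^ (n + 2)) := fun θ => by ring
  simp_rw [this]
  rw [intervalIntegral.integral_const_mul, intervalIntegral.integral_sub, arcsineMoment,
    arcsineMoment]
  · ring
  all_goals exact Continuous.intervalIntegrable (by fun_prop) _ _

theorem integral_pow_powerSemicircleLaw32 (n : ℕ) :
    ∫ x, x ^ n ∂powerSemicircleLaw32 =
      8 / 3 * (arcsineMoment n - 2 * arcsineMoment (n + 2) + arcsineMoment (n + 4)) := by
  rw [powerSemicircleLaw32, integral_pow_lawOfDensity
    (q := fun s => 8 / (3 * Real.pi) * (1 - s ^ 2) ^ 2) (by fun_prop)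
    (fun x hx => by have := one_sub_sq_nonneg hx; positivity)
    fun _ => cos_mul_powerSemicircle32_density]
  have : ∀ θ : ℝ, 8 / (3 * Real.pi) * (1 - Real.sin θ ^ 2) ^ 2 * Real.sin θ ^ n =
      8 / (3 * Real.pi) *
        (Real.sin θ ^ n - 2 * Real.sin θ ^ (n + 2) + Real.sin θ ^ (n + 4)) := fun θ => by ring
  simp_rw [this]
  rw [intervalIntegral.integral_const_mul, intervalIntegral.integral_add,
    intervalIntegral.integral_sub, intervalIntegral.integral_const_mul]
  · simp only [arcsineMoment]
    field_simp
  all_goals exact Continuous.intervalIntegrable (by fun_prop) _ _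

theorem integral_pow_powerSemicircleLaw52 (n : ℕ) :
    ∫ x, x ^ n ∂powerSemicircleLaw52 =
      16 / 5 * (arcsineMoment n - 3 * arcsineMoment (n + 2) + 3 * arcsineMoment (n + 4) -
        arcsineMoment (n + 6)) := by
  rw [powerSemicircleLaw52, integral_pow_lawOfDensity
    (q := fun s => 16 / (5 * Real.pi) * (1 - s ^ 2) ^ 3) (by fun_prop)
    (fun x hx => by have := one_sub_sq_nonneg hx; positivity)
    fun _ => cos_mul_powerSemicircle52_density]
  have : ∀ θ : ℝ, 16 / (5 * Real.pi) * (1 - Real.sin θ ^ 2) ^ 3 * Real.sin θ ^ n =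
      16 / (5 * Real.pi) * (Real.sin θ ^ n - 3 * Real.sin θ ^ (n + 2) +
        3 * Real.sin θ ^ (n + 4) - Real.sin θ ^ (n + 6)) := fun θ => by ring
  simp_rw [this]
  rw [intervalIntegral.integral_const_mul, intervalIntegral.integral_sub,
    intervalIntegral.integral_add, intervalIntegral.integral_sub,
    intervalIntegral.integral_const_mul, intervalIntegral.integral_const_mul]
  · simp only [arcsineMoment]
    field_simp
  all_goals exact Continuous.intervalIntegrable (by fun_prop) _ _

/-! ### Power series identities for the moment series. -/

section PowerSeriesIdentities

open PowerSeries

theorem momentSeries_injective (d : ℕ) : Function.Injective (momentSeries d) := by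
  intro a b h
  ext n
  have := congrArg (coeff n) h
  simp only [momentSeries, coeff_mk] at this
  have hc : ((n + d).choose d : ℝ) ≠ 0 := by
    exact_mod_cast (Nat.choose_pos (Nat.le_add_left d n)).ne'
  exact mul_left_cancel₀ hc this

theorem momentSeries_zero (a : ℕ → ℝ) : momentSeries 0 a = mk a := by
  ext n
  simp [momentSeries]

theorem momentSeries_one (a : ℕ → ℝ) : momentSeries 1 a = d⁄dX ℝ (X * mk a) := by
  ext n
  rw [coeff_derivative, coeff_succ_X_mul]
  simp [momentSeries, mul_comm]

/-- The cofactor `f² + f g + g²` has constant term 3, hence is nonzero in a domain. -/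
theorem pow_three_injective {f g : PowerSeries ℝ} (hf : constantCoeff f = 1)
    (hg : constantCoeff g = 1) (h : f ^ 3 = g ^ 3) : f = g := by
  have h0 : (f - g) * (f ^ 2 + f * g + g ^ 2) = 0 := by linear_combination h
  rcases mul_eq_zero.1 h0 with h1 | h1
  · exact sub_eq_zero.1 h1
  · have := congrArg constantCoeff h1
    simp [hf, hg] at this
    norm_num at this

/-- Multiplied by `3 X²`, each side is the derivative of `(X A)³`, which has no constant term. So
the cubes agree, and the cube root is unique. This gives the converse in (e). -/
theorem mk_sq_mul_momentSeries_one_injective {a b : ℕ → ℝ} (ha : a 0 = 1) (hb : b 0 = 1)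
    (h : mk a ^ 2 * momentSeries 1 a = mk b ^ 2 * momentSeries 1 b) : a = b := by
  have hd : d⁄dX ℝ ((X * mk a) ^ 3) = d⁄dX ℝ ((X * mk b) ^ 3) := by
    rw [derivative_pow, derivative_pow, ← momentSeries_one, ← momentSeries_one]
    push_cast
    linear_combination 3 * X ^ 2 * h
  have h3 : (X * mk a) ^ 3 = (X * mk b) ^ 3 := derivative.ext hd (by simp)
  rw [mul_pow, mul_pow] at h3
  have := pow_three_injective (by simpa using ha) (by simpa using hb)
    (mul_left_cancel₀ (pow_ne_zero 3 X_ne_zero) h3)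
  apply momentSeries_injective 0
  rw [momentSeries_zero, momentSeries_zero, this]

theorem cast_add_choose_succ (n d : ℕ) :
    ((n + (d + 1)).choose (d + 1) : ℝ) = (n + d + 1) / (d + 1) * (n + d).choose d := by
  have := Nat.add_one_mul_choose_eq (n + d) d
  have h : ((n + d + 1 : ℕ) : ℝ) * (n + d).choose d = (n + d + 1).choose (d + 1) * (d + 1 : ℕ) := by
    exact_mod_cast this
  push_cast at h
  rw [← add_assoc]
  field_simp
  linarith

variable {a : ℕ → ℝ}

theorem X_sq_mul_mk (a : ℕ → ℝ) :
    X ^ 2 * mk (fun n => a (n + 2)) = mk a - C (a 0) - C (a 1) * X := by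
  ext n
  rcases n with _ | _ | n
  · simp [coeff_X_pow_mul']
  · simp [coeff_X_pow_mul']
  · simp [coeff_X_pow_mul']

theorem one_sub_X_sq_mul_mk_eq {a b : ℕ → ℝ} (h0 : b 0 = a 0) (h1 : b 1 = a 1)
    (h : ∀ n, b (n + 2) - b n = a (n + 2)) : (1 - X ^ 2) * mk b = mk a := by
  have hb := X_sq_mul_mk b
  have ha := X_sq_mul_mk a
  have : mk (fun n => b (n + 2)) - mk b = mk fun n => a (n + 2) := by
    ext n
    simpa using h n
  rw [h0, h1] at hb
  linear_combination ha - hb + X ^ 2 * this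

/-- The moment recurrence says that the series of moments is `(1 - t²)^(-1/2)`. -/
theorem mk_arcsine_sq (h0 : a 0 = 1) (h1 : a 1 = 0)
    (h : ∀ n, a (n + 2) = (n + 1) / (n + 2) * a n) : (1 - X ^ 2) * mk a ^ 2 = 1 := by
  -- The recurrence is the differential equation `(1 - t²) A' = t A`, which makes the derivative of
  -- `(1 - t²) A²` vanish.
  have hode : (1 - X ^ 2) * d⁄dX ℝ (mk a) = X * mk a := by
    have e1 : (1 - X ^ 2) * d⁄dX ℝ (mk a) = d⁄dX ℝ (mk a) - X * (X * d⁄dX ℝ (mk a)) := by ring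
    rw [e1]
    ext n
    rcases n with _ | _ | n
    · simp only [map_sub, coeff_derivative, coeff_zero_X_mul, coeff_mk]
      simp [h1]
    · have := h 0
      simp [coeff_derivative, coeff_succ_X_mul, h0] at this ⊢
      rw [this]; norm_num
    · simp only [coeff_derivative, coeff_succ_X_mul, map_sub, coeff_mk]
      rw [h (n + 1)]
      push_cast
      field_simp
      ring
  refine derivative.ext ?_ (by simp [h0])
  rw [Derivation.leibniz, derivative_pow]
  simp only [smul_eq_mul, map_sub, derivative_pow, derivative_one, derivative_X]
  push_cast
  linear_combination 2 * mk a * hode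

/-- The moments attached to the density proportional to `(1 - x²)^(1/2)`, in terms of arcsine
moments; similarly below for exponents `3/2` and `5/2`. -/
theorem semicircle_moment_eq (h : ∀ n, a (n + 2) = (n + 1) / (n + 2) * a n) (n : ℕ) :
    2 * (a n - a (n + 2)) = 2 * a n / (n + 2) := by
  rw [h]
  field_simp
  ring

theorem powerSemicircle32_moment_eq (h : ∀ n, a (n + 2) = (n + 1) / (n + 2) * a n) (n : ℕ) :
    8 / 3 * (a n - 2 * a (n + 2) + a (n + 4)) = 8 * a n / ((n + 2) * (n + 4)) := by
  rw [h (n + 2), h]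
  push_cast
  field_simp
  ring

theorem powerSemicircle52_moment_eq (h : ∀ n, a (n + 2) = (n + 1) / (n + 2) * a n) (n : ℕ) :
    16 / 5 * (a n - 3 * a (n + 2) + 3 * a (n + 4) - a (n + 6)) =
      48 * a n / ((n + 2) * (n + 4) * (n + 6)) := by
  rw [h (n + 4), h (n + 2), h]
  push_cast
  field_simp
  ring

theorem momentSeries_two_semicircle (a : ℕ → ℝ) :
    momentSeries 2 (fun n => 2 * a n / (n + 2)) = mk fun n => (n + 1) * a n := by
  ext n
  simp only [momentSeries, coeff_mk, cast_add_choose_succ]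
  simp
  field_simp
  ring

theorem momentSeries_three_semicircle (a : ℕ → ℝ) :
    momentSeries 3 (fun n => 2 * a n / (n + 2)) = mk fun n => (n + 3) * (n + 1) * a n / 3 := by
  ext n
  simp only [momentSeries, coeff_mk, cast_add_choose_succ]
  simp
  field_simp
  ring

/-- The same series arises from the semicircle moments with `d = 3`; by `mk_add_three_mul` it equals
`B⁵` for arcsine moments. -/
theorem momentSeries_four_powerSemicircle32 (a : ℕ → ℝ) :
    momentSeries 4 (fun n => 8 * a n / ((n + 2) * (n + 4))) =
      mk fun n => (n + 3) * (n + 1) * a n / 3 := by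
  ext n
  simp only [momentSeries, coeff_mk, cast_add_choose_succ]
  simp
  field_simp
  ring

/-- Multiplication by `1 - t²` returns `B`, and `B² = (1 - t²)⁻¹`. -/
theorem mk_add_one_mul (h0 : a 0 = 1) (h1 : a 1 = 0)
    (h : ∀ n, a (n + 2) = (n + 1) / (n + 2) * a n) : mk (fun n => (n + 1) * a n) = mk a ^ 3 := by
  have h2 : (1 - X ^ 2) * mk (fun n => (n + 1) * a n) = mk a :=
    one_sub_X_sq_mul_mk_eq (by simp) (by simp [h1]) fun n => by
      rw [h]; push_cast; field_simp; ring
  linear_combination mk a ^ 2 * h2 - mk (fun n => (n + 1) * a n) * mk_arcsine_sq h0 h1 h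

theorem mk_add_three_mul (h0 : a 0 = 1) (h1 : a 1 = 0)
    (h : ∀ n, a (n + 2) = (n + 1) / (n + 2) * a n) :
    mk (fun n => (n + 3) * (n + 1) * a n / 3) = mk a ^ 5 := by
  have h2 : (1 - X ^ 2) * mk (fun n => (n + 3) * (n + 1) * a n / 3) =
      mk fun n => (n + 1) * a n :=
    one_sub_X_sq_mul_mk_eq (by simp) (by simp [h1]) fun n => by
      rw [h]; push_cast; field_simp; ring
  rw [mk_add_one_mul h0 h1 h] at h2
  linear_combination mk a ^ 2 * h2 -
    mk (fun n => (n + 3) * (n + 1) * a n / 3) * mk_arcsine_sq h0 h1 h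

/-- Here `(1 - t²) B` plays the role of `√(1 - t²)`, so the semicircle series is `2 (1 - √(1 - t²))
/ t²`. -/
theorem X_sq_mul_mk_semicircle (h0 : a 0 = 1) (h1 : a 1 = 0)
    (h : ∀ n, a (n + 2) = (n + 1) / (n + 2) * a n) :
    X ^ 2 * mk (fun n => 2 * a n / (n + 2)) = 2 * (1 - (1 - X ^ 2) * mk a) := by
  have e : mk (fun n => 2 * a n / (n + 2)) = 2 * (mk a - mk fun n => a (n + 2)) := by
    ext n
    rw [two_mul, map_add, map_sub, coeff_mk, coeff_mk, coeff_mk, ← semicircle_moment_eq h]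
    ring
  have h2 := X_sq_mul_mk a
  rw [h0, h1, map_one, map_zero] at h2
  linear_combination X ^ 2 * e - 2 * h2

theorem X_pow_four_mul_mk (h0 : a 0 = 1) (h1 : a 1 = 0)
    (h : ∀ n, a (n + 2) = (n + 1) / (n + 2) * a n) :
    X ^ 4 * mk (fun n => a (n + 4)) = mk a - 1 - C (1 / 2) * X ^ 2 := by
  have h2 := X_sq_mul_mk a
  have h4 := X_sq_mul_mk fun n => a (n + 2)
  have e0 : a 2 = 1 / 2 := by rw [h 0, h0]; norm_num
  have e1 : a 3 = 0 := by rw [h 1, h1]; norm_num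
  simp only [zero_add, Nat.reduceAdd, h0, h1, e0, e1, map_one, map_zero, add_assoc] at h2 h4
  linear_combination h2 + X ^ 2 * h4

theorem X_pow_six_mul_mk (h0 : a 0 = 1) (h1 : a 1 = 0)
    (h : ∀ n, a (n + 2) = (n + 1) / (n + 2) * a n) :
    X ^ 6 * mk (fun n => a (n + 6)) = mk a - 1 - C (1 / 2) * X ^ 2 - C (3 / 8) * X ^ 4 := by
  have h4 := X_pow_four_mul_mk h0 h1 h
  have h6 := X_sq_mul_mk fun n => a (n + 4)
  have e0 : a 4 = 3 / 8 := by rw [h 2, h 0, h0]; norm_num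
  have e1 : a 5 = 0 := by rw [h 3, h 1, h1]; norm_num
  simp only [zero_add, Nat.reduceAdd, e0, e1, map_zero, add_assoc] at h6
  linear_combination h4 + X ^ 4 * h6

theorem mk_semicircle_sq_mul (h0 : a 0 = 1) (h1 : a 1 = 0)
    (h : ∀ n, a (n + 2) = (n + 1) / (n + 2) * a n) :
    mk (fun n => 2 * a n / (n + 2)) ^ 2 * mk a =
      momentSeries 2 fun n => 8 * a n / ((n + 2) * (n + 4)) := by
  -- The recurrence turns the rational coefficients into shifts of `a`. After multiplication by `X ^
  -- 4` everything becomes a polynomial in `X` and `B`, reduced by `(1 - X²) B² = 1`.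
  have e : (momentSeries 2 fun n => 8 * a n / ((n + 2) * (n + 4))) =
      C 8 * mk (fun n => a (n + 4)) - C 4 * mk fun n => a (n + 2) := by
    ext n
    simp only [momentSeries, coeff_mk, cast_add_choose_succ, map_sub, coeff_C_mul]
    rw [h (n + 2), h]
    simp
    field_simp
    ring
  have hs := X_sq_mul_mk_semicircle h0 h1 h
  have h2 := X_sq_mul_mk a
  have h4 := X_pow_four_mul_mk h0 h1 h
  have hB := mk_arcsine_sq h0 h1 h
  rw [h0, h1, map_one, map_zero] at h2
  apply mul_left_cancel₀ (pow_ne_zero 4 (X_ne_zero (R := ℝ)))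
  have c8 : (C (8 : ℝ)) = 8 := map_ofNat C 8
  have c4 : (C (4 : ℝ)) = 4 := map_ofNat C 4
  have c2 : 2 * (C (1 / 2 : ℝ)) = 1 := by
    rw [← map_ofNat C 2, ← map_mul]; norm_num
  rw [e, c8, c4]
  set s := mk fun n : ℕ => 2 * a n / (n + 2)
  set B := mk a
  have e2 : (X ^ 2 * s) ^ 2 * B = (2 * (1 - (1 - X ^ 2) * B)) ^ 2 * B := by rw [hs]
  linear_combination e2 - 8 * h4 + 4 * X ^ 2 * h2 + 4 * X ^ 2 * c2 +
    (-8 + 4 * (1 - X ^ 2) * B) * hB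

theorem mk_semicircle_pow_three (h0 : a 0 = 1) (h1 : a 1 = 0)
    (h : ∀ n, a (n + 2) = (n + 1) / (n + 2) * a n) :
    mk (fun n => 2 * a n / (n + 2)) ^ 3 =
      momentSeries 2 fun n => 48 * a n / ((n + 2) * (n + 4) * (n + 6)) := by
  -- Same method with one more shift, hence the factor `X ^ 6` below.
  have e : (momentSeries 2 fun n => 48 * a n / ((n + 2) * (n + 4) * (n + 6))) =
      C 40 * mk (fun n => a (n + 4)) - C 32 * mk (fun n => a (n + 6)) -
        C 8 * mk fun n => a (n + 2) := by
    ext n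
    simp only [momentSeries, coeff_mk, cast_add_choose_succ, map_sub, coeff_C_mul]
    rw [h (n + 4), h (n + 2), h]
    simp
    field_simp
    ring
  have hs := X_sq_mul_mk_semicircle h0 h1 h
  have h2 := X_sq_mul_mk a
  have h4 := X_pow_four_mul_mk h0 h1 h
  have h6 := X_pow_six_mul_mk h0 h1 h
  have hB := mk_arcsine_sq h0 h1 h
  rw [h0, h1, map_one, map_zero] at h2
  apply mul_left_cancel₀ (pow_ne_zero 6 (X_ne_zero (R := ℝ)))
  have c40 : (C (40 : ℝ)) = 40 := map_ofNat C 40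
  have c32 : (C (32 : ℝ)) = 32 := map_ofNat C 32
  have c8 : (C (8 : ℝ)) = 8 := map_ofNat C 8
  have c2 : 2 * (C (1 / 2 : ℝ)) = 1 := by
    rw [← map_ofNat C 2, ← map_mul]; norm_num
  have c38 : 8 * (C (3 / 8 : ℝ)) = 3 := by
    rw [← map_ofNat C 8, ← map_ofNat C 3, ← map_mul]; norm_num
  rw [e, c40, c32, c8]
  set s := mk fun n : ℕ => 2 * a n / (n + 2)
  set B := mk a
  have e2 : (X ^ 2 * s) ^ 3 = (2 * (1 - (1 - X ^ 2) * B)) ^ 3 := by rw [hs]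
  linear_combination e2 - 40 * X ^ 2 * h4 + 32 * h6 + 8 * X ^ 4 * h2 +
    (20 * X ^ 4 - 16 * X ^ 2) * c2 - 4 * X ^ 4 * c38 +
    (24 * (1 - X ^ 2) - 8 * (1 - X ^ 2) ^ 2 * B) * hB

end PowerSeriesIdentities

/-! ### Weighted averages as spacing averages with repeated values. -/

theorem rwa_fin_three {Ω : Type*} {N : ℕ} (p q r : ℕ) (U : Fin N → Ω → ℝ) (X : Fin 3 → Ω → ℝ)
    (ω : Ω) :
    rwa ![p, q, r] U X ω =
      orderStat (fun i => U i ω) p * X 0 ω +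
      (orderStat (fun i => U i ω) (p + q) - orderStat (fun i => U i ω) p) * X 1 ω +
      (orderStat (fun i => U i ω) (p + q + r) - orderStat (fun i => U i ω) (p + q)) * X 2 ω := by
  have h0 : (Finset.Iic 0 : Finset (Fin 3)) = {0} := by decide
  have h1 : (Finset.Iic 1 : Finset (Fin 3)) = {0, 1} := by decide
  have h2 : (Finset.Iic 2 : Finset (Fin 3)) = {0, 1, 2} := by decide
  have g0 : (Finset.Iio 0 : Finset (Fin 3)) = ∅ := by decide
  have g1 : (Finset.Iio 1 : Finset (Fin 3)) = {0} := by decide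
  have g2 : (Finset.Iio 2 : Finset (Fin 3)) = {0, 1} := by decide
  simp [rwa, rwaWeight, Fin.sum_univ_three, h0, h1, h2, g0, g1, g2, orderStat, add_assoc]

/-- The blocks `0 | 1 | 2, 2, …`. -/
def blocksOneOne (i : ℕ) : Fin 3 := if i = 0 then 0 else if i = 1 then 1 else 2

/-- The blocks `0, 0, 0 | 1 | 2, 2, …`. -/
def blocksThreeOne (i : ℕ) : Fin 3 := if i < 3 then 0 else if i = 3 then 1 else 2

theorem rwa_one_one_one {Ω : Type*} (U : Fin 2 → Ω → ℝ) (X : Fin 3 → Ω → ℝ) :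
    rwa ![1, 1, 1] U X = spacingAverage blocksOneOne U X := by
  ext ω
  simp [rwa_fin_three, spacingAverage, spacingSum, orderStat, blocksOneOne]

/-- The block map of the case `(1, 1, 1)` serves again: the extra index falls in the last block,
whose two spacings telescope to one weight. -/
theorem rwa_one_one_two {Ω : Type*} (U : Fin 3 → Ω → ℝ) (X : Fin 3 → Ω → ℝ) :
    rwa ![1, 1, 2] U X = spacingAverage blocksOneOne U X := by
  ext ω
  simp [rwa_fin_three, spacingAverage, spacingSum, orderStat, blocksOneOne]
  ring_nf

theorem rwa_three_one_one {Ω : Type*} (U : Fin 4 → Ω → ℝ) (X : Fin 3 → Ω → ℝ) :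
    rwa ![3, 1, 1] U X = spacingAverage blocksThreeOne U X := by
  ext ω
  simp [rwa_fin_three, spacingAverage, spacingSum, orderStat, blocksThreeOne]
  ring_nf

/-! ### The four laws as moment sequences, and the final assembly. -/

section

variable {Ω : Type*} [MeasurableSpace Ω] {P : Measure Ω} [IsProbabilityMeasure P] {Y : Ω → ℝ}

theorem hasLaw_arcsineLaw_iff (hY : Measurable Y) (hYm : ∀ᵐ ω ∂P, Y ω ∈ Set.Icc (-1 : ℝ) 1) :
    HasLaw Y arcsineLaw P ↔ (fun k : ℕ => ∫ ω, Y ω ^ k ∂P) = arcsineMoment := by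
  rw [hasLaw_iff_moments (ν := arcsineLaw) hY.aemeasurable hYm (lawOfDensity_mem_Icc _), funext_iff]
  simp_rw [integral_pow_arcsineLaw]

theorem hasLaw_semicircleLaw_iff (hY : Measurable Y) (hYm : ∀ᵐ ω ∂P, Y ω ∈ Set.Icc (-1 : ℝ) 1) :
    HasLaw Y semicircleLaw P ↔
      (fun k : ℕ => ∫ ω, Y ω ^ k ∂P) = fun n : ℕ => 2 * arcsineMoment n / (n + 2) := by
  rw [hasLaw_iff_moments (ν := semicircleLaw) hY.aemeasurable hYm (lawOfDensity_mem_Icc _), funext_iff]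
  simp_rw [integral_pow_semicircleLaw, semicircle_moment_eq arcsineMoment_add_two]

theorem hasLaw_powerSemicircleLaw32_iff (hY : Measurable Y)
    (hYm : ∀ᵐ ω ∂P, Y ω ∈ Set.Icc (-1 : ℝ) 1) :
    HasLaw Y powerSemicircleLaw32 P ↔ (fun k : ℕ => ∫ ω, Y ω ^ k ∂P) =
      fun n : ℕ => 8 * arcsineMoment n / ((n + 2) * (n + 4)) := by
  rw [hasLaw_iff_moments (ν := powerSemicircleLaw32) hY.aemeasurable hYm (lawOfDensity_mem_Icc _), funext_iff]
  simp_rw [integral_pow_powerSemicircleLaw32, powerSemicircle32_moment_eq arcsineMoment_add_two]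

theorem hasLaw_powerSemicircleLaw52_iff (hY : Measurable Y)
    (hYm : ∀ᵐ ω ∂P, Y ω ∈ Set.Icc (-1 : ℝ) 1) :
    HasLaw Y powerSemicircleLaw52 P ↔ (fun k : ℕ => ∫ ω, Y ω ^ k ∂P) =
      fun n : ℕ => 48 * arcsineMoment n / ((n + 2) * (n + 4) * (n + 6)) := by
  rw [hasLaw_iff_moments (ν := powerSemicircleLaw52) hY.aemeasurable hYm (lawOfDensity_mem_Icc _), funext_iff]
  simp_rw [integral_pow_powerSemicircleLaw52, powerSemicircle52_moment_eq arcsineMoment_add_two]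

end

theorem mk_pow_three_inj {a b : ℕ → ℝ} (ha : a 0 = 1) (hb : b 0 = 1) :
    PowerSeries.mk a ^ 3 = PowerSeries.mk b ^ 3 ↔ a = b := by
  refine ⟨fun h => momentSeries_injective 0 ?_, fun h => by rw [h]⟩
  rw [momentSeries_zero, momentSeries_zero]
  exact pow_three_injective (by simpa using ha) (by simpa using hb) h

theorem mk_ne_zero {a : ℕ → ℝ} (ha : a 0 = 1) : PowerSeries.mk a ≠ 0 := by
  intro h
  have := congrArg (PowerSeries.coeff 0) h
  simp [ha] at this

theorem theorem2 {Ω : Type*} [MeasurableSpace Ω] (P : Measure Ω) [IsProbabilityMeasure P]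
    (X : Fin 3 → Ω → ℝ) (hX : ∀ i, Measurable (X i))
    (hX_mem : ∀ i, ∀ᵐ ω ∂P, X i ω ∈ Set.Icc (-1 : ℝ) 1)
    (hX_indep : iIndepFun X P) :
    -- `(m₁, m₂, m₃) = (1, 1, 1)`
    (∀ U : Fin 2 → Ω → ℝ, IsUniformSampleIndepOf P U X →
      -- (a)
      ((∀ i j, IdentDistrib (X i) (X j) P P) →
        (HasLaw (rwa ![1, 1, 1] U X) semicircleLaw P ↔ ∀ i, HasLaw (X i) arcsineLaw P)) ∧
      -- (b)
      ((∀ i j, IdentDistrib (X i) (X j) P P) →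
        ((∀ i, HasLaw (X i) semicircleLaw P) ↔
          HasLaw (rwa ![1, 1, 1] U X) powerSemicircleLaw52 P)) ∧
      -- (c)
      (HasLaw (X 0) semicircleLaw P → HasLaw (X 1) semicircleLaw P →
        (HasLaw (X 2) arcsineLaw P ↔ HasLaw (rwa ![1, 1, 1] U X) powerSemicircleLaw32 P))) ∧
    -- `(m₁, m₂, m₃) = (3, 1, 1)`
    (∀ U : Fin 4 → Ω → ℝ, IsUniformSampleIndepOf P U X →
      -- (d)
      (HasLaw (X 1) arcsineLaw P → HasLaw (X 2) arcsineLaw P →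
        (HasLaw (X 0) semicircleLaw P ↔ HasLaw (rwa ![3, 1, 1] U X) powerSemicircleLaw32 P))) ∧
    -- `(m₁, m₂, m₃) = (1, 1, 2)`
    (∀ U : Fin 3 → Ω → ℝ, IsUniformSampleIndepOf P U X →
      -- (e)
      ((∀ i j, IdentDistrib (X i) (X j) P P) →
        ((∀ i, HasLaw (X i) arcsineLaw P) ↔ HasLaw (rwa ![1, 1, 2] U X) semicircleLaw P))) := by
  have a0 := arcsineMoment_zero
  have a1 := arcsineMoment_one
  have ar := arcsineMoment_add_two
  have hB : PowerSeries.mk arcsineMoment ≠ 0 := mk_ne_zero a0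
  have s0 : (fun n : ℕ => 2 * arcsineMoment n / (n + 2)) 0 = 1 := by norm_num [a0]
  have hmom0 : ∀ j, (fun k : ℕ => ∫ ω, X j ω ^ k ∂P) 0 = 1 := fun j => by simp
  have hmom : (∀ i j, IdentDistrib (X i) (X j) P P) →
      ∀ j, (fun k : ℕ => ∫ ω, X j ω ^ k ∂P) = fun k : ℕ => ∫ ω, X 0 ω ^ k ∂P := fun hid j =>
    funext fun k => ((hid j 0).comp (measurable_id.pow_const k)).integral_eq
  refine ⟨fun U hU => ?_, fun U hU => ?_, fun U hU => ?_⟩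
  · rw [rwa_one_one_one]
    have hSm := measurable_spacingAverage blocksOneOne hU hX
    have hSI := spacingAverage_mem_Icc blocksOneOne hU hX_mem
    -- The entries of `![0, 0, 0]` are the multiplicities minus one.
    have key := momentSeries_spacingAverage blocksOneOne hU hX hX_mem hX_indep ![0, 0, 0] (by
      intro f
      simp [Finset.prod_range_succ, Fin.prod_univ_three, blocksOneOne])
    simp only [Fin.prod_univ_three, Matrix.cons_val_zero, Matrix.cons_val_one, Matrix.cons_val,
      momentSeries_zero] at key
    refine ⟨fun hid => ?_, fun hid => ?_, fun hX0 hX1 => ?_⟩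
    · simp_rw [hasLaw_semicircleLaw_iff hSm hSI, hasLaw_arcsineLaw_iff (hX _) (hX_mem _)]
      rw [hmom hid 1, hmom hid 2] at key
      simp_rw [hmom hid]
      rw [forall_const, ← mk_pow_three_inj (hmom0 0) a0, ← mk_add_one_mul a0 a1 ar,
        ← momentSeries_two_semicircle, ← (momentSeries_injective 2).eq_iff
        (a := fun k => ∫ ω, spacingAverage blocksOneOne U X ω ^ k ∂P), key]
      ring_nf
    · simp_rw [hasLaw_powerSemicircleLaw52_iff hSm hSI, hasLaw_semicircleLaw_iff (hX _) (hX_mem _)]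
      rw [hmom hid 1, hmom hid 2] at key
      simp_rw [hmom hid]
      rw [forall_const, ← mk_pow_three_inj (hmom0 0) s0, mk_semicircle_pow_three a0 a1 ar,
        ← (momentSeries_injective 2).eq_iff
        (a := fun k => ∫ ω, spacingAverage blocksOneOne U X ω ^ k ∂P), key]
      ring_nf
    · rw [hasLaw_semicircleLaw_iff (hX _) (hX_mem _)] at hX0 hX1
      rw [hasLaw_arcsineLaw_iff (hX _) (hX_mem _), hasLaw_powerSemicircleLaw32_iff hSm hSI,
        ← (momentSeries_injective 2).eq_iff
        (a := fun k => ∫ ω, spacingAverage blocksOneOne U X ω ^ k ∂P), key, hX0, hX1, ← mk_semicircle_sq_mul a0 a1 ar, ← sq,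
        mul_right_inj' (pow_ne_zero 2 (mk_ne_zero s0)), ← momentSeries_zero, ← momentSeries_zero,
        (momentSeries_injective 0).eq_iff]
  · rw [rwa_three_one_one]
    have hSm := measurable_spacingAverage blocksThreeOne hU hX
    have hSI := spacingAverage_mem_Icc blocksThreeOne hU hX_mem
    have key := momentSeries_spacingAverage blocksThreeOne hU hX hX_mem hX_indep ![2, 0, 0] (by
      intro f
      simp [Finset.prod_range_succ, Fin.prod_univ_three, blocksThreeOne, pow_succ])
    simp only [Fin.prod_univ_three, Matrix.cons_val_zero, Matrix.cons_val_one, Matrix.cons_val,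
      momentSeries_zero] at key
    intro hX1 hX2
    rw [hasLaw_arcsineLaw_iff (hX _) (hX_mem _)] at hX1 hX2
    -- The two arcsine factors cancel from `B⁵`, leaving `B³`, the semicircle series for `d = 2`.
    have h5 : PowerSeries.mk arcsineMoment ^ 5 =
        PowerSeries.mk arcsineMoment ^ 3 * PowerSeries.mk arcsineMoment *
          PowerSeries.mk arcsineMoment := by ring
    rw [hasLaw_semicircleLaw_iff (hX _) (hX_mem _), hasLaw_powerSemicircleLaw32_iff hSm hSI,
      ← (momentSeries_injective 4).eq_iff
        (a := fun k => ∫ ω, spacingAverage blocksThreeOne U X ω ^ k ∂P), key, hX1, hX2, momentSeries_four_powerSemicircle32,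
      mk_add_three_mul a0 a1 ar, h5, mul_left_inj' hB, mul_left_inj' hB, ← mk_add_one_mul a0 a1 ar,
      ← momentSeries_two_semicircle, (momentSeries_injective 2).eq_iff]
  · intro hid
    rw [rwa_one_one_two]
    have hSm := measurable_spacingAverage blocksOneOne hU hX
    have hSI := spacingAverage_mem_Icc blocksOneOne hU hX_mem
    have key := momentSeries_spacingAverage blocksOneOne hU hX hX_mem hX_indep ![0, 0, 1] (by
      intro f
      simp [Finset.prod_range_succ, Fin.prod_univ_three, blocksOneOne]
      ring)
    simp only [Fin.prod_univ_three, Matrix.cons_val_zero, Matrix.cons_val_one, Matrix.cons_val,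
      momentSeries_zero] at key
    simp_rw [hasLaw_semicircleLaw_iff hSm hSI, hasLaw_arcsineLaw_iff (hX _) (hX_mem _)]
    rw [hmom hid 1, hmom hid 2, ← sq] at key
    simp_rw [hmom hid]
    -- For arcsine moments `(tB)' = B³`, so both sides are `B⁵`.
    have hG : PowerSeries.mk arcsineMoment ^ 2 * momentSeries 1 arcsineMoment =
        momentSeries 3 fun n => 2 * arcsineMoment n / (n + 2) := by
      have h1 : momentSeries 1 arcsineMoment = PowerSeries.mk fun n => (n + 1) * arcsineMoment n := by
        ext n
        simp [momentSeries]
      rw [momentSeries_three_semicircle, mk_add_three_mul a0 a1 ar, h1, mk_add_one_mul a0 a1 ar]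
      ring
    rw [forall_const, ← (momentSeries_injective 3).eq_iff
        (a := fun k => ∫ ω, spacingAverage blocksOneOne U X ω ^ k ∂P), key, ← hG]
    exact ⟨fun h => by rw [h], mk_sq_mul_momentSeries_one_injective (hmom0 0) a0⟩
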